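/- Let $\mathcal{A}=(\mathcal{A},\mathbb{E},\mathfrak{s})$ be a Krull–Schmidt extriangulated category (in the sense of Nakaoka–Palu); subcategories are full, additive and closed under isomorphisms. A \emph{semibrick} is a set $\mathcal{X}$ of isomorphism classes of objects whose endomorphism rings are division rings, such that $\mathrm{Hom}(X_1,X_2)=0$ for non-isomorphic $X_1,X_2\in\mathcal{X}$. $\mathrm{Filt}(\mathcal{X})$ is the subcategory of objects $M$ that admit a filtration $0=M_0\to M_1\to\cdots\to M_n=M$ by inflations with cones in $\mathcal{X}$, and $l_{\mathcal{X}}(M)$ is the minimal such $n$. Let $\mathcal{C}\subseteq\mathcal{A}$ be an extension-closed subcategory; its $\mathbb{E}$-triangles are the $\mathbb{E}$-triangles of $\mathcal{A}$ with all terms in $\mathcal{C}$. A \emph{length function} on $\mathcal{C}$ is a map $\Theta$ from isomorphism classes of objects of $\mathcal{C}$ to $\mathbb{N}$ such that $\Theta(X)=0$ iff $X\cong 0$, and $\Theta(L)\le\Theta(X)+\Theta(M)$ for every $\mathbb{E}$-triangle $X\to L\to M\overset{\delta}{\dashrightarrow}$ in $\mathcal{C}$, with equality if $\delta=0$. Such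 a triangle is \emph{$\Theta$-stable} if equality holds; its first and second morphisms are then called a $\Theta$-inflation and a $\Theta$-deflation. Let $\Theta_1$ be the class of non-zero objects of $\mathcal{C}$ of minimal $\Theta$; for $n\ge 2$ let $\Theta_n$ be the union of $\Theta_{n-1}$ and the class of objects $M$ of $\mathcal{C}$ with $\Theta(M)=n$ that have no non-zero morphism from or to an object of $\Theta_{n-1}$; and let $\Theta_\infty=\bigcup_{n\ge1}\Theta_n$. The pair $(\mathcal{C},\Theta)$ is a \emph{length wide subcategory} if $\Theta$ is a length function with $\Theta(M)=1$ for all $M\in\Theta_1$, every morphism of $\mathcal{C}$ is a $\Theta$-deflation followed by a $\Theta$-inflation, and $\Theta_1=\Theta_\infty$. Let $\mathrm{sim}(\mathcal{C})$ be the set of isomorphism classes of non-zero objects $M$ of $\mathcal{C}$ for which there is no $\Theta$-stable $\mathbb{E}$-triangle $A\to M\to B\dashrightarrow$ in $\mathcal{C}$ with $A,B\neq0$. Theorem. The assignments $$\mathcal{X}\mapsto(\mathrm{Filt}(\mathcal{X}),l_{\mathcal{X}}),\qquad (\mathcal{C},\Theta)\mapsto\mathrm{sim}(\mathcal{C})$$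 are mutually inverse bijections between the semibricks in $\mathcal{A}$ and the length wide subcategories $(\mathcal{C},\Theta)$ in $\mathcal{A}$. -/

import Mathlib

open CategoryTheory CategoryTheory.Limits Opposite

universe w v u

namespace Extri

section Extension

variable {C : Type u} [Category.{v} C] (E : Cᵒᵖ ⥤ C ⥤ AddCommGrpCat.{w})

/-- The abelian group `𝔼(Z, X)` of extensions of `Z` by `X`. -/
abbrev Ext (Z X : C) : Type w := (E.obj (op Z)).obj X

variable {E}

/-- `a_* δ = 𝔼(Z, a)(δ)`. -/
def push {Z X X' : C} (a : X ⟶ X') (δ : Ext E Z X) : Ext E Z X' :=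
  ((E.obj (op Z)).map a).hom δ

/-- `c^* δ = 𝔼(c, X)(δ)`. -/
def pull {Z Z' X : C} (c : Z' ⟶ Z) (δ : Ext E Z X) : Ext E Z' X :=
  ((E.map c.op).app X).hom δ

/-- The direct sum `δ ⊕ δ'` of two extensions: the element of `𝔼(Z ⊞ Z', X ⊞ X')` with
components `(δ, 0, 0, δ')`. -/
noncomputable def extSum [Preadditive C] [HasBinaryBiproducts C] {Z X Z' X' : C}
    (δ : Ext E Z X) (δ' : Ext E Z' X') : Ext E (Z ⊞ Z') (X ⊞ X') :=
  push biprod.inl (pull biprod.fst δ) + push biprod.inr (pull biprod.snd δ')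

end Extension

section Sequences

variable {C : Type u} [Category.{v} C]

/-- A sequence `X ⟶ Y ⟶ Z` with fixed end terms. -/
structure Seq (X Z : C) where
  mid : C
  f : X ⟶ mid
  g : mid ⟶ Z

/-- Two sequences with the same end terms are equivalent if there is an isomorphism of the middle
terms that is compatible with the identities of the end terms. -/
instance seqSetoid (X Z : C) : Setoid (Seq X Z) where
  r S T := ∃ h : S.mid ≅ T.mid, S.f ≫ h.hom = T.f ∧ h.hom ≫ T.g = S.g
  iseqv :=
    { refl := fun S => ⟨Iso.refl _, by simp, by simp⟩
      symm := by
        rintro S T ⟨h, h₁, h₂⟩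
        exact ⟨h.symm, by simp [← h₁], by simp [← h₂]⟩
      trans := by
        rintro S T U ⟨h, h₁, h₂⟩ ⟨k, k₁, k₂⟩
        exact ⟨h ≪≫ k, by simp [← k₁, ← h₁], by simp [k₂, h₂]⟩ }

end Sequences

section Structure

variable (C : Type u) [Category.{v} C] [Preadditive C] [HasZeroObject C] [HasBinaryBiproducts C]

/-- An extriangulated structure `(𝔼, 𝔰)` on an additive category, in the sense of Nakaoka and
Palu. The field `s` is the correspondence `𝔰`, and an equation `s δ = ⟦⟨B, x, y⟩⟧` says that
`A --x--> B --y--> D` realizes `δ ∈ 𝔼(D, A)`. -/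
structure ExtriangulatedStructure where
  /-- the bifunctor `𝔼` -/
  E : Cᵒᵖ ⥤ C ⥤ AddCommGrpCat.{w}
  /-- (ET1): `𝔼` is additive in the covariant variable -/
  additive_right : ∀ Z : Cᵒᵖ, (E.obj Z).Additive
  /-- (ET1): `𝔼` is additive in the contravariant variable -/
  additive_left : ∀ X : C, (E.flip.obj X).Additive
  /-- the correspondence `𝔰` -/
  s : ∀ {D A : C}, Ext E D A → Quotient (seqSetoid A D)
  /-- (ET2): `𝔰` is a realization of `𝔼` -/
  realization : ∀ {A B D A' B' D' : C} {x : A ⟶ B} {y : B ⟶ D} {x' : A' ⟶ B'} {y' : B' ⟶ D'}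
    {δ : Ext E D A} {δ' : Ext E D' A'}, s δ = ⟦⟨B, x, y⟩⟧ → s δ' = ⟦⟨B', x', y'⟩⟧ →
    ∀ (a : A ⟶ A') (c : D ⟶ D'), push a δ = pull c δ' →
      ∃ b : B ⟶ B', x ≫ b = a ≫ x' ∧ y ≫ c = b ≫ y'
  /-- (ET2): the realization is additive, zero extensions -/
  realization_zero : ∀ (A D : C),
    s (0 : Ext E D A) = ⟦⟨A ⊞ D, biprod.inl, biprod.snd⟩⟧
  /-- (ET2): the realization is additive, direct sums -/
  realization_sum : ∀ {A B D A' B' D' : C} {x : A ⟶ B} {y : B ⟶ D} {x' : A' ⟶ B'}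
    {y' : B' ⟶ D'} {δ : Ext E D A} {δ' : Ext E D' A'}, s δ = ⟦⟨B, x, y⟩⟧ →
    s δ' = ⟦⟨B', x', y'⟩⟧ →
      s (extSum δ δ') = ⟦⟨B ⊞ B', biprod.map x x', biprod.map y y'⟩⟧
  /-- (ET3) -/
  et3 : ∀ {A B D A' B' D' : C} {x : A ⟶ B} {y : B ⟶ D} {x' : A' ⟶ B'} {y' : B' ⟶ D'}
    {δ : Ext E D A} {δ' : Ext E D' A'}, s δ = ⟦⟨B, x, y⟩⟧ → s δ' = ⟦⟨B', x', y'⟩⟧ →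
    ∀ (a : A ⟶ A') (b : B ⟶ B'), x ≫ b = a ≫ x' →
      ∃ c : D ⟶ D', y ≫ c = b ≫ y' ∧ push a δ = pull c δ'
  /-- (ET3)ᵒᵖ -/
  et3op : ∀ {A B D A' B' D' : C} {x : A ⟶ B} {y : B ⟶ D} {x' : A' ⟶ B'} {y' : B' ⟶ D'}
    {δ : Ext E D A} {δ' : Ext E D' A'}, s δ = ⟦⟨B, x, y⟩⟧ → s δ' = ⟦⟨B', x', y'⟩⟧ →
    ∀ (b : B ⟶ B') (c : D ⟶ D'), y ≫ c = b ≫ y' →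
      ∃ a : A ⟶ A', x ≫ b = a ≫ x' ∧ push a δ = pull c δ'
  /-- (ET4) -/
  et4 : ∀ {A B D M F : C} {f : A ⟶ B} {f' : B ⟶ D} {g : B ⟶ M} {g' : M ⟶ F}
    {δ : Ext E D A} {δ' : Ext E F B}, s δ = ⟦⟨B, f, f'⟩⟧ → s δ' = ⟦⟨M, g, g'⟩⟧ →
      ∃ (N : C) (d : D ⟶ N) (e : N ⟶ F) (h' : M ⟶ N) (δ'' : Ext E N A),
        s δ'' = ⟦⟨M, f ≫ g, h'⟩⟧ ∧ g ≫ h' = f' ≫ d ∧ h' ≫ e = g' ∧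
        s (push f' δ') = ⟦⟨N, d, e⟩⟧ ∧ pull d δ'' = δ ∧ push f δ'' = pull e δ'
  /-- (ET4)ᵒᵖ -/
  et4op : ∀ {A B D M F : C} {f' : D ⟶ A} {f : A ⟶ B} {g' : F ⟶ B} {g : B ⟶ M}
    {δ : Ext E B D} {δ' : Ext E M F}, s δ = ⟦⟨A, f', f⟩⟧ → s δ' = ⟦⟨B, g', g⟩⟧ →
      ∃ (N : C) (d : D ⟶ N) (e : N ⟶ F) (h' : N ⟶ A) (δ'' : Ext E M N),
        s δ'' = ⟦⟨A, h', f ≫ g⟩⟧ ∧ h' ≫ f = e ≫ g' ∧ d ≫ h' = f' ∧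
        s (pull g' δ) = ⟦⟨N, d, e⟩⟧ ∧ push e δ'' = δ' ∧ pull g δ'' = push d δ

/-- An additive category is Krull-Schmidt if every object is a finite direct sum of objects with
local endomorphism rings. -/
def IsKrullSchmidt : Prop :=
  ∀ M : C, ∃ (n : ℕ) (X : Fin n → C) (b : Bicone X),
    Nonempty b.IsBilimit ∧ Nonempty (b.pt ≅ M) ∧ ∀ i, IsLocalRing (End (X i))

end Structure

variable {C : Type u} [Category.{v} C] [Preadditive C] [HasZeroObject C] [HasBinaryBiproducts C]

/-- The endomorphism ring of `M` is a division ring. -/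
def IsBrick (M : C) : Prop :=
  Nontrivial (End M) ∧ ∀ f : End M, f ≠ 0 → IsUnit f

/-- A semibrick. A set of isomorphism classes of objects is given by the corresponding
isomorphism-closed property of objects. -/
structure IsSemibrick (X : ObjectProperty C) : Prop where
  iso_closed : X.IsClosedUnderIsomorphisms
  brick : ∀ M, X M → IsBrick M
  hom_eq_zero : ∀ M N, X M → X N → ¬ Nonempty (M ≅ N) → ∀ f : M ⟶ N, f = 0

variable (𝓔 : ExtriangulatedStructure.{w} C)

/-- `A --x--> B --y--> D --δ-->` is an `𝔼`-triangle. -/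
def IsTriangle {A B D : C} (x : A ⟶ B) (y : B ⟶ D) (δ : Ext 𝓔.E D A) : Prop :=
  𝓔.s δ = ⟦⟨B, x, y⟩⟧

/-- `M` admits a filtration `0 = M₀ ⟶ M₁ ⟶ ⋯ ⟶ Mₙ = M` of length `n` by inflations whose cones
are in `X`. -/
inductive HasFiltration (X : ObjectProperty C) : ℕ → C → Prop
  | zero (M : C) (hM : IsZero M) : HasFiltration X 0 M
  | succ {n : ℕ} {L M S : C} (f : L ⟶ M) (g : M ⟶ S) (δ : Ext 𝓔.E S L)
      (hL : HasFiltration X n L) (h : IsTriangle 𝓔 f g δ) (hS : X S) : HasFiltration X (n + 1) M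

/-- The filtration subcategory generated by `X`. -/
def Filt (X : ObjectProperty C) : ObjectProperty C :=
  fun M => ∃ n, HasFiltration 𝓔 X n M

/-- The `X`-length of an object of `Filt X`: the minimal length of its `X`-filtrations. -/
noncomputable def filtLength (X : ObjectProperty C) (M : (Filt 𝓔 X).FullSubcategory) : ℕ :=
  sInf {n | HasFiltration 𝓔 X n M.obj}

/-- An extension-closed (full, isomorphism-closed, additive) subcategory. It carries the
restrictions of `𝔼` and `𝔰`, so that its `𝔼`-triangles are the `𝔼`-triangles of the ambient
category all of whose terms are in `P`. -/
structure IsExtensionClosed (P : ObjectProperty C) : Prop where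
  iso_closed : P.IsClosedUnderIsomorphisms
  zero_mem : ∀ M, IsZero M → P M
  ext_mem : ∀ {A B D : C} (x : A ⟶ B) (y : B ⟶ D) (δ : Ext 𝓔.E D A),
    IsTriangle 𝓔 x y δ → P A → P D → P B

section Length

variable {P : ObjectProperty C} (Θ : P.FullSubcategory → ℕ)

/-- `Θ` is a length function on the extension-closed subcategory `P`. A function on isomorphism
classes is given by a function on objects that is invariant under isomorphism. -/
structure IsLengthFunction : Prop where
  iso_invariant : ∀ M N : P.FullSubcategory, Nonempty (M.obj ≅ N.obj) → Θ M = Θ N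
  eq_zero_iff : ∀ M : P.FullSubcategory, Θ M = 0 ↔ IsZero M.obj
  le_add : ∀ {X L M : P.FullSubcategory} (x : X.obj ⟶ L.obj) (y : L.obj ⟶ M.obj)
    (δ : Ext 𝓔.E M.obj X.obj), IsTriangle 𝓔 x y δ → Θ L ≤ Θ X + Θ M
  eq_add : ∀ {X L M : P.FullSubcategory} (x : X.obj ⟶ L.obj) (y : L.obj ⟶ M.obj),
    IsTriangle 𝓔 x y 0 → Θ L = Θ X + Θ M

/-- A `Θ`-stable `𝔼`-triangle of the subcategory `P`. -/
def IsStableTriangle {X L M : P.FullSubcategory} (x : X.obj ⟶ L.obj) (y : L.obj ⟶ M.obj)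
    (δ : Ext 𝓔.E M.obj X.obj) : Prop :=
  IsTriangle 𝓔 x y δ ∧ Θ L = Θ X + Θ M

/-- `Θ`-inflations. -/
def IsThetaInflation {X L : P.FullSubcategory} (x : X.obj ⟶ L.obj) : Prop :=
  ∃ (M : P.FullSubcategory) (y : L.obj ⟶ M.obj) (δ : Ext 𝓔.E M.obj X.obj),
    IsStableTriangle 𝓔 Θ x y δ

/-- `Θ`-deflations. -/
def IsThetaDeflation {L M : P.FullSubcategory} (y : L.obj ⟶ M.obj) : Prop :=
  ∃ (X : P.FullSubcategory) (x : X.obj ⟶ L.obj) (δ : Ext 𝓔.E M.obj X.obj),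
    IsStableTriangle 𝓔 Θ x y δ

/-- `f` is `Θ`-admissible: it is a `Θ`-deflation followed by a `Θ`-inflation. -/
def IsAdmissible {M N : P.FullSubcategory} (f : M.obj ⟶ N.obj) : Prop :=
  ∃ (Z : P.FullSubcategory) (i : M.obj ⟶ Z.obj) (j : Z.obj ⟶ N.obj),
    i ≫ j = f ∧ IsThetaDeflation 𝓔 Θ i ∧ IsThetaInflation 𝓔 Θ j

/-- The class `Θ₁` of the non-zero objects of minimal length. -/
def thetaOne (M : P.FullSubcategory) : Prop :=
  ¬ IsZero M.obj ∧ ∀ N : P.FullSubcategory, ¬ IsZero N.obj → Θ M ≤ Θ N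

/-- `thetaLevel Θ n` is the class `Θₙ₊₁`: it starts with `Θ₁`, and `Θₙ₊₂` is the union of `Θₙ₊₁`
and the class of the objects of length `n + 2` that have no non-zero morphism from or to an object
of `Θₙ₊₁`. -/
def thetaLevel : ℕ → P.FullSubcategory → Prop
  | 0 => thetaOne Θ
  | n + 1 => fun M => thetaLevel n M ∨
      ((∀ N : P.FullSubcategory, thetaLevel n N →
          (∀ f : N.obj ⟶ M.obj, f = 0) ∧ (∀ f : M.obj ⟶ N.obj, f = 0)) ∧ Θ M = n + 2)

/-- The union `Θ_∞` of all `Θₙ`, `n ≥ 1`. -/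
def thetaInfty (M : P.FullSubcategory) : Prop :=
  ∃ n, thetaLevel Θ n M

/-- `(P, Θ)` is a length subcategory. Length functions are normalized: the objects in `Θ₁` have
length `1`. -/
structure IsLengthSubcategory : Prop where
  extensionClosed : IsExtensionClosed 𝓔 P
  lengthFunction : IsLengthFunction 𝓔 Θ
  admissible : ∀ {M N : P.FullSubcategory} (f : M.obj ⟶ N.obj), IsAdmissible 𝓔 Θ f
  normalized : ∀ M : P.FullSubcategory, thetaOne Θ M → Θ M = 1

/-- A simple object of `(P, Θ)`: a non-zero object that is not the middle term of a `Θ`-stable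
`𝔼`-triangle with non-zero end terms. -/
def IsSimple (M : P.FullSubcategory) : Prop :=
  ¬ IsZero M.obj ∧ ¬ ∃ (A B : P.FullSubcategory) (x : A.obj ⟶ M.obj) (y : M.obj ⟶ B.obj)
    (δ : Ext 𝓔.E B.obj A.obj), IsStableTriangle 𝓔 Θ x y δ ∧ ¬ IsZero A.obj ∧ ¬ IsZero B.obj

end Length

/-- A pair `(P, Θ)` of a full subcategory and a function on its objects. -/
abbrev SubcategoryWithLength (C : Type u) [Category.{v} C] : Type u :=
  Σ P : ObjectProperty C, (P.FullSubcategory → ℕ)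

/-- `(P, Θ)` is a length wide subcategory: a length subcategory with `Θ₁ = Θ_∞`. -/
def IsLengthWide (W : SubcategoryWithLength C) : Prop :=
  IsLengthSubcategory 𝓔 W.2 ∧ thetaOne W.2 = thetaInfty W.2

/-- The pair `(Filt X, l_X)`. -/
noncomputable def filtPair (X : ObjectProperty C) : SubcategoryWithLength C :=
  ⟨Filt 𝓔 X, filtLength 𝓔 X⟩

/-- The class of simple objects of `(P, Θ)`. -/
def sim (W : SubcategoryWithLength C) : ObjectProperty C :=
  fun M => ∃ h : W.1 M, IsSimple 𝓔 W.2 ⟨M, h⟩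

end Extri

/-!
A non-zero morphism from an object of `Filt X` to an object of the semibrick `X` is a deflation
whose cocone has a filtration shorter by one: refine a filtration along the morphism until a
component between two objects of `X` is non-zero, hence an isomorphism. Dually for morphisms from
an object of `X`. Removing such factors one at a time shows that the length is additive on split
triangles.

Let `g` be a morphism of `Filt X` that is injective on morphisms from the objects of `X`. Dividing
source and target by a common subobject `S ∈ X` induces a morphism with the same property, which is
a stable inflation by induction on the length. Going back with (ET4)ᵒᵖ yields a stable inflation
that agrees with `g` up to a morphism factoring through the inclusion `x` of `S`; it becomes `g`
after an automorphism of the form `1 + k ≫ x`. An arbitrary `g` is admissible because dividing its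
source by the objects of `X` that it kills leads to the injective case.

Conversely, Schur's lemma makes the simple objects of a length subcategory a semibrick. If
`Θ₁ = Θ_∞`, then simple objects have length `1`: otherwise a simple object of length `n ≥ 2` would
have no non-zero morphisms from or to the objects of `Θₙ₋₁ = Θ₁`, and hence lie in `Θₙ = Θ₁`. So
`Θ` is the filtration length, as it is subadditive and every object that is not simple sits in a
stable triangle with non-zero ends.
-/

namespace Extri

section Preadditive

variable {C : Type u} [Category.{v} C]

lemma isIso_of_isIso_comp_of_isIso_comp {A B : C} (a : A ⟶ B) (b : B ⟶ A) [IsIso (a ≫ b)]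
    [IsIso (b ≫ a)] : IsIso a := by
  have : IsSplitMono a := ⟨⟨b ≫ inv (a ≫ b), by rw [← Category.assoc, IsIso.hom_inv_id]⟩⟩
  have : Epi a := epi_of_epi b a
  exact isIso_of_epi_of_isSplitMono a

/-- The morphism `g` is a monomorphism as far as test objects from `X` are concerned: composition
with `g` is injective on morphisms starting in `X`. The inflations of `Filt X` that are stable for
`filtLength` turn out to be recognized by this property. -/
def IsMonoOn [HasZeroMorphisms C] (X : ObjectProperty C) {Y Z : C} (g : Y ⟶ Z) : Prop :=
  ∀ ⦃S : C⦄, X S → ∀ s : S ⟶ Y, s ≫ g = 0 → s = 0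

variable [Preadditive C]

lemma isIso_id_add_of_comp_self_eq_zero {A : C} (a : A ⟶ A) (h : a ≫ a = 0) :
    IsIso (𝟙 A + a) :=
  ⟨𝟙 A - a, by simp [Preadditive.comp_sub, Preadditive.add_comp, h],
    by simp [Preadditive.sub_comp, Preadditive.comp_add, h]⟩

lemma IsBrick.not_isZero {M : C} (hM : IsBrick M) : ¬ IsZero M := fun h =>
  have := hM.1
  zero_ne_one (α := End M) (h.eq_of_src _ _)

lemma IsSemibrick.isIso_of_ne_zero {X : ObjectProperty C} (hX : IsSemibrick X) {S T : C}
    (hS : X S) (hT : X T) (f : S ⟶ T) (hf : f ≠ 0) : IsIso f := by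
  obtain ⟨e⟩ : Nonempty (S ≅ T) := by
    by_contra h
    exact hf (hX.hom_eq_zero S T hS hT h f)
  have hfe : f ≫ e.inv ≠ 0 := fun h => hf (by simpa using h =≫ e.hom)
  have : IsIso (f ≫ e.inv) :=
    (isUnit_iff_isIso (f ≫ e.inv)).1 ((hX.brick S hS).2 (f ≫ e.inv : End S) hfe)
  exact IsIso.of_isIso_comp_right f e.inv

end Preadditive

section ThetaLevel

variable {C : Type u} [Category.{v} C] [Preadditive C] {P : ObjectProperty C}
  {Θ : P.FullSubcategory → ℕ}

lemma thetaLevel_of_thetaOne {M : P.FullSubcategory} (hM : thetaOne Θ M) (n : ℕ) :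
    thetaLevel Θ n M := by
  induction n with
  | zero => exact hM
  | succ n ih => exact Or.inl ih

lemma thetaOne_eq_thetaInfty (h : ∀ M : P.FullSubcategory, Θ M ≠ 0 →
    ∃ (N : P.FullSubcategory) (f : M.obj ⟶ N.obj), thetaOne Θ N ∧ f ≠ 0) :
    thetaOne Θ = thetaInfty Θ := by
  have thetaOne_of_thetaLevel (n : ℕ) {M : P.FullSubcategory} (hM : thetaLevel Θ n M) :
      thetaOne Θ M := by
    induction n with
    | zero => exact hM
    | succ n ih =>
      obtain hM | ⟨hM, hn⟩ := hM
      · exact ih hM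
      · obtain ⟨N, f, hN, hf⟩ := h M (by lia)
        exact absurd ((hM N (thetaLevel_of_thetaOne hN n)).2 f) hf
  funext M
  exact propext ⟨fun hM => ⟨0, hM⟩, fun ⟨n, hM⟩ => thetaOne_of_thetaLevel n hM⟩

end ThetaLevel

variable {C : Type u} [Category.{v} C]

lemma SubcategoryWithLength.ext {V W : SubcategoryWithLength C} (h : V.1 = W.1)
    (hl : ∀ M hV hW, V.2 ⟨M, hV⟩ = W.2 ⟨M, hW⟩) : V = W := by
  obtain ⟨P, Θ⟩ := V
  obtain ⟨Q, Θ'⟩ := W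
  obtain rfl : P = Q := h
  exact congrArg _ (funext fun M => hl M.obj M.property M.property)

section Functoriality

variable {E : Cᵒᵖ ⥤ C ⥤ AddCommGrpCat.{w}}

@[simp]
lemma push_id {Z X : C} (δ : Ext E Z X) : push (𝟙 X) δ = δ := by
  simp [push]

@[simp]
lemma pull_id {Z X : C} (δ : Ext E Z X) : pull (𝟙 Z) δ = δ := by
  simp [pull]

lemma push_comp {Z X X' X'' : C} (a : X ⟶ X') (b : X' ⟶ X'') (δ : Ext E Z X) :
    push (a ≫ b) δ = push b (push a δ) := by
  simp [push]

lemma pull_comp {Z Z' Z'' X : C} (a : Z'' ⟶ Z') (b : Z' ⟶ Z) (δ : Ext E Z X) :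
    pull (a ≫ b) δ = pull a (pull b δ) := by
  simp [pull]

lemma push_pull {Z Z' X X' : C} (a : X ⟶ X') (c : Z' ⟶ Z) (δ : Ext E Z X) :
    push a (pull c δ) = pull c (push a δ) :=
  (ConcreteCategory.congr_hom ((E.map c.op).naturality a) δ).symm

@[simp]
lemma push_zero {Z X X' : C} (a : X ⟶ X') : push a (0 : Ext E Z X) = 0 :=
  map_zero _

@[simp]
lemma pull_zero {Z Z' X : C} (c : Z' ⟶ Z) : pull c (0 : Ext E Z X) = 0 :=
  map_zero _

lemma push_inv_eq_pull_inv {Z Z' X X' : C} (a : X ⟶ X') [IsIso a] (c : Z ⟶ Z') [IsIso c]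
    {δ : Ext E Z X} {δ' : Ext E Z' X'} (h : push a δ = pull c δ') :
    push (inv a) δ' = pull (inv c) δ :=
  calc push (inv a) δ' = push (inv a) (pull (inv c) (pull c δ')) := by
        rw [← pull_comp, IsIso.inv_hom_id, pull_id]
    _ = pull (inv c) (push (inv a) (push a δ)) := by rw [← h, push_pull]
    _ = pull (inv c) δ := by rw [← push_comp, IsIso.hom_inv_id, push_id]

end Functoriality

variable [Preadditive C] [HasBinaryBiproducts C] {𝓔 : ExtriangulatedStructure.{w} C}

section Additivity

lemma push_sub {Z X X' : C} (a b : X ⟶ X') (δ : Ext 𝓔.E Z X) :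
    push (a - b) δ = push a δ - push b δ := by
  have := 𝓔.additive_right (op Z)
  simp [push, Functor.map_sub]

@[simp]
lemma zero_push {Z X X' : C} (δ : Ext 𝓔.E Z X) : push (0 : X ⟶ X') δ = 0 := by
  rw [← sub_self 0, push_sub, sub_self]

@[simp]
lemma zero_pull {Z Z' X : C} (δ : Ext 𝓔.E Z X) : pull (0 : Z' ⟶ Z) δ = 0 := by
  have := 𝓔.additive_left X
  have h : (𝓔.E.map (0 : Z' ⟶ Z).op).app X = 0 := (𝓔.E.flip.obj X).map_zero (op Z) (op Z')
  rw [pull, h]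
  rfl

lemma ext_eq_zero_of_isZero_left {Z X : C} (hZ : IsZero Z) (δ : Ext 𝓔.E Z X) : δ = 0 := by
  rw [← pull_id δ, hZ.eq_of_src (𝟙 Z) 0, zero_pull]

lemma ext_eq_zero_of_isZero_right {Z X : C} (hX : IsZero X) (δ : Ext 𝓔.E Z X) : δ = 0 := by
  rw [← push_id δ, hX.eq_of_src (𝟙 X) 0, zero_push]

end Additivity

namespace IsTriangle

variable {A B D A' B' D' : C} {x : A ⟶ B} {y : B ⟶ D} {δ : Ext 𝓔.E D A}
  {x' : A' ⟶ B'} {y' : B' ⟶ D'} {δ' : Ext 𝓔.E D' A'}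

lemma of_iso {x' : A ⟶ B'} {y' : B' ⟶ D} (h : IsTriangle 𝓔 x y δ) (e : B ≅ B')
    (hx : x ≫ e.hom = x') (hy : e.hom ≫ y' = y) : IsTriangle 𝓔 x' y' δ :=
  Eq.trans h (Quotient.sound ⟨e, hx, hy⟩)

lemma exists_iso {x' : A ⟶ B'} {y' : B' ⟶ D} (h : IsTriangle 𝓔 x y δ)
    (h' : IsTriangle 𝓔 x' y' δ) : ∃ e : B ≅ B', x ≫ e.hom = x' ∧ e.hom ≫ y' = y :=
  Quotient.exact (h.symm.trans h')

lemma exists_of_ext (δ : Ext 𝓔.E D A) :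
    ∃ (B : C) (x : A ⟶ B) (y : B ⟶ D), IsTriangle 𝓔 x y δ :=
  have ⟨⟨B, x, y⟩, h⟩ := Quotient.exists_rep (𝓔.s δ)
  ⟨B, x, y, h.symm⟩

lemma biprod (A D : C) : IsTriangle 𝓔 (biprod.inl : A ⟶ A ⊞ D) biprod.snd 0 :=
  𝓔.realization_zero A D

section Exactness

-- Comparison with split triangles; their middle terms are of the form `T ⊞ T`, as there need not
-- be a zero object.

lemma comp_eq_zero (h : IsTriangle 𝓔 x y δ) : x ≫ y = 0 := by
  obtain ⟨c, hc, -⟩ := 𝓔.et3 (biprod (𝓔 := 𝓔) A A) h (𝟙 A) (biprod.desc x 0) (by simp)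
  simpa using biprod.inl ≫= hc.symm

lemma exists_lift (h : IsTriangle 𝓔 x y δ) {T : C} (t : T ⟶ B) (ht : t ≫ y = 0) :
    ∃ s : T ⟶ A, s ≫ x = t := by
  obtain ⟨s, hs, -⟩ := 𝓔.et3op (biprod (𝓔 := 𝓔) T T) h (biprod.desc t 0) 0
    (by ext <;> simp [ht])
  exact ⟨s, by simpa using hs.symm⟩

lemma exists_desc (h : IsTriangle 𝓔 x y δ) {T : C} (t : B ⟶ T) (ht : x ≫ t = 0) :
    ∃ s : D ⟶ T, y ≫ s = t := by
  obtain ⟨s, hs, -⟩ := 𝓔.et3 h (biprod (𝓔 := 𝓔) T T) 0 (t ≫ biprod.inr) (by simp [reassoc_of% ht])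
  exact ⟨s, by simpa using hs⟩

lemma exists_extend (h : IsTriangle 𝓔 x y δ) {T : C} (a : A ⟶ T) (ha : push a δ = 0) :
    ∃ r : B ⟶ T, x ≫ r = a := by
  obtain ⟨b, hb, -⟩ := 𝓔.realization h (biprod (𝓔 := 𝓔) T T) a 0 (by simp [ha])
  exact ⟨b ≫ biprod.fst, by simp [reassoc_of% hb]⟩

lemma exists_coextend (h : IsTriangle 𝓔 x y δ) {T : C} (c : T ⟶ D) (hc : pull c δ = 0) :
    ∃ r : T ⟶ B, r ≫ y = c := by
  obtain ⟨b, -, hb⟩ := 𝓔.realization (biprod (𝓔 := 𝓔) T T) h 0 c (by simp [hc])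
  exact ⟨biprod.inr ≫ b, by simp [← hb]⟩

lemma push_eq_zero (h : IsTriangle 𝓔 x y δ) : push x δ = 0 := by
  obtain ⟨c, -, hc⟩ := 𝓔.et3 h (biprod (𝓔 := 𝓔) B B) x biprod.inl rfl
  simpa using hc

lemma pull_eq_zero (h : IsTriangle 𝓔 x y δ) : pull y δ = 0 := by
  obtain ⟨c, -, hc⟩ := 𝓔.et3op (biprod (𝓔 := 𝓔) B B) h biprod.snd y rfl
  simpa using hc.symm

end Exactness

section Split

lemma of_splitting {S : ShortComplex C} (σ : S.Splitting) : IsTriangle 𝓔 S.f S.g 0 :=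
  (biprod S.X₁ S.X₃).of_iso σ.isoBinaryBiproduct.symm (by simp) (by ext <;> simp)

lemma nonempty_splitting (h : IsTriangle 𝓔 x y (0 : Ext 𝓔.E D A)) :
    Nonempty (ShortComplex.mk x y h.comp_eq_zero).Splitting := by
  obtain ⟨e, hx, hy⟩ := (biprod A D).exists_iso h
  exact ⟨(ShortComplex.Splitting.ofHasBinaryBiproduct A D).ofIso
    (ShortComplex.isoMk (Iso.refl _) e (Iso.refl _) (by simp [hx]) (by simp [hy]))⟩

lemma of_isIso_left (x : A ⟶ B) [IsIso x] (y : B ⟶ D) (hD : IsZero D) : IsTriangle 𝓔 x y 0 :=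
  of_splitting (S := .mk x y (hD.eq_of_tgt _ _)) (.ofIsIsoOfIsZero _ ‹_› hD)

lemma of_isIso_right (x : A ⟶ B) (y : B ⟶ D) [IsIso y] (hA : IsZero A) : IsTriangle 𝓔 x y 0 :=
  of_splitting (S := .mk x y (hA.eq_of_src _ _)) (.ofIsZeroOfIsIso _ hA ‹_›)

lemma isIso_left (h : IsTriangle 𝓔 x y δ) (hD : IsZero D) : IsIso x := by
  obtain rfl := ext_eq_zero_of_isZero_left hD δ
  obtain ⟨σ⟩ := h.nonempty_splitting
  exact ⟨σ.r, σ.f_r, by simp [σ.r_f, hD.eq_of_tgt y 0]⟩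

lemma isIso_right (h : IsTriangle 𝓔 x y δ) (hA : IsZero A) : IsIso y := by
  obtain rfl := ext_eq_zero_of_isZero_right hA δ
  obtain ⟨σ⟩ := h.nonempty_splitting
  exact ⟨σ.s, by simp [σ.g_s, hA.eq_of_src x 0], σ.s_g⟩

lemma exists_cone_of_isIso_comp (h : IsTriangle 𝓔 x y δ) {S : C} (i : S ⟶ B) [IsIso (i ≫ y)] :
    ∃ r : B ⟶ A, IsTriangle 𝓔 i r 0 := by
  obtain rfl : δ = 0 := by
    rw [← pull_id δ, ← IsIso.inv_hom_id (i ≫ y), ← Category.assoc, pull_comp, h.pull_eq_zero,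
      pull_zero]
  obtain ⟨σ⟩ := h.nonempty_splitting
  have hi : i ≫ y ≫ inv (i ≫ y) = 𝟙 S := by rw [← Category.assoc, IsIso.hom_inv_id]
  have hiy : inv (i ≫ y) ≫ i ≫ y = 𝟙 D := IsIso.inv_hom_id _
  have hxy : x ≫ y = 0 := h.comp_eq_zero
  have hxr : x ≫ σ.r = 𝟙 A := σ.f_r
  have hrx : σ.r ≫ x = 𝟙 B - y ≫ σ.s := σ.r_f
  -- the retraction `σ.r` onto `A`, corrected so as to vanish on `S`
  exact ⟨σ.r - y ≫ inv (i ≫ y) ≫ i ≫ σ.r, of_splitting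
    (S := .mk i _ (by simp [Preadditive.comp_sub, reassoc_of% hi]))
    { r := y ≫ inv (i ≫ y)
      s := x
      f_r := hi
      s_g := by simp [Preadditive.comp_sub, hxr, reassoc_of% hxy]
      id := by simp [Preadditive.comp_sub, Preadditive.sub_comp, hrx, reassoc_of% hiy] }⟩

lemma exists_cocone_of_isIso_comp (h : IsTriangle 𝓔 x y δ) {S : C} (f : B ⟶ S)
    [IsIso (x ≫ f)] : ∃ k : D ⟶ B, IsTriangle 𝓔 k f 0 := by
  obtain rfl : δ = 0 := by
    rw [← push_id δ, ← IsIso.hom_inv_id (x ≫ f), Category.assoc, push_comp, h.push_eq_zero,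
      push_zero]
  obtain ⟨σ⟩ := h.nonempty_splitting
  have hfx : x ≫ f ≫ inv (x ≫ f) = 𝟙 A := by rw [← Category.assoc, IsIso.hom_inv_id]
  have hxf : inv (x ≫ f) ≫ x ≫ f = 𝟙 S := IsIso.inv_hom_id _
  have hxy : x ≫ y = 0 := h.comp_eq_zero
  have hsy : σ.s ≫ y = 𝟙 D := σ.s_g
  have hys : y ≫ σ.s = 𝟙 B - σ.r ≫ x := σ.g_s
  exact ⟨σ.s - σ.s ≫ f ≫ inv (x ≫ f) ≫ x, of_splitting
    (S := .mk _ f (by simp [Preadditive.sub_comp, hxf]))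
    { r := y
      s := inv (x ≫ f) ≫ x
      f_r := by simp [Preadditive.sub_comp, hsy, hxy]
      s_g := by simp
      id := by
        simp [Preadditive.comp_sub, Preadditive.sub_comp, reassoc_of% hys, hys, reassoc_of% hfx] }⟩

end Split

section FiveLemma

lemma isIso_of_comp_eq_self_of_push_eq_self (h : IsTriangle 𝓔 x y δ) (a : A ⟶ A)
    (hax : a ≫ x = x) (ha : push a δ = δ) : IsIso a := by
  obtain ⟨r, hr⟩ := h.exists_extend (a - 𝟙 A) (by simp [push_sub, ha])
  have hx : (a - 𝟙 A) ≫ x = 0 := by simp [Preadditive.sub_comp, hax]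
  have : IsIso (𝟙 A + (a - 𝟙 A)) := isIso_id_add_of_comp_self_eq_zero _ <|
    calc (a - 𝟙 A) ≫ (a - 𝟙 A) = (a - 𝟙 A) ≫ x ≫ r := by rw [hr]
      _ = 0 := by rw [reassoc_of% hx, zero_comp]
  rwa [add_sub_cancel] at this

lemma isIso_of_comp_eq_self (h : IsTriangle 𝓔 x y δ) (b : B ⟶ B) (hxb : x ≫ b = x)
    (hby : b ≫ y = y) : IsIso b := by
  obtain ⟨r, hr⟩ := h.exists_desc (b - 𝟙 B) (by simp [Preadditive.comp_sub, hxb])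
  have hy : (b - 𝟙 B) ≫ y = 0 := by simp [Preadditive.sub_comp, hby]
  have : IsIso (𝟙 B + (b - 𝟙 B)) := isIso_id_add_of_comp_self_eq_zero _ <|
    calc (b - 𝟙 B) ≫ (b - 𝟙 B) = (b - 𝟙 B) ≫ y ≫ r := by rw [hr]
      _ = 0 := by rw [reassoc_of% hy, zero_comp]
  rwa [add_sub_cancel] at this

lemma isIso_fst (h : IsTriangle 𝓔 x y δ) (h' : IsTriangle 𝓔 x' y' δ') (a : A ⟶ A') (b : B ⟶ B')
    (c : D ⟶ D') [IsIso b] [IsIso c] (hab : x ≫ b = a ≫ x') (hbc : y ≫ c = b ≫ y')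
    (hac : push a δ = pull c δ') : IsIso a := by
  obtain ⟨a', ha', hac'⟩ := 𝓔.et3op h' h (inv b) (inv c)
    (by rw [IsIso.comp_inv_eq, Category.assoc, hbc, IsIso.inv_hom_id_assoc])
  have : IsIso (a ≫ a') := h.isIso_of_comp_eq_self_of_push_eq_self _
    (by rw [Category.assoc, ← ha', ← reassoc_of% hab, IsIso.hom_inv_id, Category.comp_id])
    (by rw [push_comp, hac, push_pull, hac', ← pull_comp, IsIso.hom_inv_id, pull_id])
  have : IsIso (a' ≫ a) := h'.isIso_of_comp_eq_self_of_push_eq_self _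
    (by rw [Category.assoc, ← hab, ← reassoc_of% ha', IsIso.inv_hom_id, Category.comp_id])
    (by rw [push_comp, hac', push_pull, hac, ← pull_comp, IsIso.inv_hom_id, pull_id])
  exact isIso_of_isIso_comp_of_isIso_comp a a'

lemma isIso_snd (h : IsTriangle 𝓔 x y δ) (h' : IsTriangle 𝓔 x' y' δ') (a : A ⟶ A') (b : B ⟶ B')
    (c : D ⟶ D') [IsIso a] [IsIso c] (hab : x ≫ b = a ≫ x') (hbc : y ≫ c = b ≫ y')
    (hac : push a δ = pull c δ') : IsIso b := by
  obtain ⟨b', hab', hbc'⟩ :=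
    𝓔.realization h' h (inv a) (inv c) (push_inv_eq_pull_inv a c hac)
  have : IsIso (b ≫ b') := h.isIso_of_comp_eq_self _
    (by rw [reassoc_of% hab, hab', IsIso.hom_inv_id_assoc])
    (by rw [Category.assoc, ← hbc', ← reassoc_of% hbc, IsIso.hom_inv_id, Category.comp_id])
  have : IsIso (b' ≫ b) := h'.isIso_of_comp_eq_self _
    (by rw [reassoc_of% hab', hab, IsIso.inv_hom_id_assoc])
    (by rw [Category.assoc, ← hbc, ← reassoc_of% hbc', IsIso.inv_hom_id, Category.comp_id])
  exact isIso_of_isIso_comp_of_isIso_comp b b'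

lemma iso_comp (h : IsTriangle 𝓔 x y δ) (a : A' ≅ A) :
    IsTriangle 𝓔 (a.hom ≫ x) y (push a.inv δ) := by
  obtain ⟨B', x', y', h'⟩ := exists_of_ext (push a.inv δ)
  obtain ⟨b, hab, hbc⟩ := 𝓔.realization h h' a.inv (𝟙 D) (by simp)
  have := h.isIso_snd h' a.inv b (𝟙 D) hab hbc (by simp)
  exact h'.of_iso (asIso b).symm (by simp [hab]) (by simp [← hbc])

lemma nonempty_iso_of_deflation {x' : A' ⟶ B} {δ' : Ext 𝓔.E D A'} (h : IsTriangle 𝓔 x y δ)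
    (h' : IsTriangle 𝓔 x' y δ') : Nonempty (A ≅ A') := by
  obtain ⟨a, hab, hac⟩ := 𝓔.et3op h h' (𝟙 B) (𝟙 D) (by simp)
  have := h.isIso_fst h' a (𝟙 B) (𝟙 D) hab (by simp) hac
  exact ⟨asIso a⟩

end FiveLemma

section Fill

variable {x' : A ⟶ B'} {y' : B' ⟶ D'} {δ' : Ext 𝓔.E D' A} {b b' : B ⟶ B'} {c : D ⟶ D'}

lemma isMonoOn_of_fill {X : ObjectProperty C} (h : IsTriangle 𝓔 x y δ)
    (h' : IsTriangle 𝓔 x' y' δ') (hab : x ≫ b = x') (hbc : y ≫ c = b ≫ y')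
    (hac : δ = pull c δ') (hb : IsMonoOn X b) : IsMonoOn X c := by
  intro T hT t ht
  obtain ⟨t, rfl⟩ := h.exists_coextend t (by rw [hac, ← pull_comp, ht, zero_pull])
  obtain ⟨k, hk⟩ := h'.exists_lift (t ≫ b) (by rw [Category.assoc, ← hbc, ← Category.assoc, ht])
  have htk : t - k ≫ x = 0 := hb hT _ (by simp [Preadditive.sub_comp, hab, hk])
  rw [sub_eq_zero.1 htk, Category.assoc, h.comp_eq_zero, comp_zero]

lemma exists_iso_comp_eq_of_fill (h' : IsTriangle 𝓔 x' y' δ') (hb : x ≫ b = x')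
    (hb' : x ≫ b' = x') (hbb' : b ≫ y' = b' ≫ y')
    (hA : ∀ s : A ⟶ B, s ≫ b = 0 → s = 0) : ∃ e : B ≅ B, e.hom ≫ b' = b := by
  obtain ⟨k, hk⟩ := h'.exists_lift (b - b') (by simp [Preadditive.sub_comp, hbb'])
  have hxk : x ≫ k ≫ x = 0 := hA _ (by simp [hb, hb', hk, Preadditive.comp_sub])
  have : IsIso (𝟙 B + k ≫ x) := isIso_id_add_of_comp_self_eq_zero _ (by simp [hxk])
  exact ⟨asIso (𝟙 B + k ≫ x), by simp [Preadditive.add_comp, hb', hk]⟩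

lemma exists_of_fill (h : IsTriangle 𝓔 x y δ) (h' : IsTriangle 𝓔 x' y' δ') (hab : x ≫ b = x')
    (hbc : y ≫ c = b ≫ y') (hac : δ = pull c δ') (hA : ∀ s : A ⟶ B, s ≫ b = 0 → s = 0)
    {W : C} {r : D' ⟶ W} {η : Ext 𝓔.E W D} (hr : IsTriangle 𝓔 c r η) :
    ∃ θ : Ext 𝓔.E W B, IsTriangle 𝓔 b (y' ≫ r) θ := by
  obtain ⟨Y, d, e, j, θ, hθ, hje, hdj, hY, -, -⟩ := 𝓔.et4op h' hr
  obtain ⟨φ, hφd, hφe⟩ := h.exists_iso (hac ▸ hY)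
  obtain ⟨ψ, hψ⟩ := h'.exists_iso_comp_eq_of_fill (b' := φ.hom ≫ j) hab
    (by rw [reassoc_of% hφd, hdj]) (by rw [Category.assoc, hje, reassoc_of% hφe, hbc]) hA
  have hj := iso_comp hθ (ψ ≪≫ φ)
  rw [Iso.trans_hom, Category.assoc, hψ] at hj
  exact ⟨_, hj⟩

end Fill

end IsTriangle

section LengthFunction

variable {P : ObjectProperty C} {Θ : P.FullSubcategory → ℕ}

namespace IsLengthFunction

lemma pos (hΘ : IsLengthFunction 𝓔 Θ) {M : P.FullSubcategory} (hM : ¬ IsZero M.obj) : 0 < Θ M :=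
  Nat.pos_of_ne_zero (mt (hΘ.eq_zero_iff M).1 hM)

lemma not_isZero_of_eq_one (hΘ : IsLengthFunction 𝓔 Θ) {M : P.FullSubcategory} (hM : Θ M = 1) :
    ¬ IsZero M.obj := fun h => by
  simp [(hΘ.eq_zero_iff M).2 h] at hM

lemma thetaOne_of_eq_one (hΘ : IsLengthFunction 𝓔 Θ) {M : P.FullSubcategory} (hM : Θ M = 1) :
    thetaOne Θ M :=
  ⟨hΘ.not_isZero_of_eq_one hM, fun _ hN => hM ▸ hΘ.pos hN⟩

lemma isSimple_of_eq_one (hΘ : IsLengthFunction 𝓔 Θ) {M : P.FullSubcategory} (hM : Θ M = 1) :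
    IsSimple 𝓔 Θ M := by
  refine ⟨hΘ.not_isZero_of_eq_one hM, ?_⟩
  rintro ⟨A, B, x, y, δ, ⟨-, hl⟩, hA, hB⟩
  have := hΘ.pos hA
  have := hΘ.pos hB
  lia

end IsLengthFunction

lemma IsThetaDeflation.comp (hP : IsExtensionClosed 𝓔 P) (hΘ : IsLengthFunction 𝓔 Θ)
    {L M N : P.FullSubcategory} {f : L.obj ⟶ M.obj} {g : M.obj ⟶ N.obj}
    (hf : IsThetaDeflation 𝓔 Θ f) (hg : IsThetaDeflation 𝓔 Θ g) :
    IsThetaDeflation 𝓔 Θ (L := L) (M := N) (f ≫ g) := by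
  obtain ⟨A, x, δ, hx, hL⟩ := hf
  obtain ⟨B, y, ε, hy, hM⟩ := hg
  obtain ⟨K, d, e, k, η, hη, -, -, hK, -, -⟩ := 𝓔.et4op hx hy
  let K' : P.FullSubcategory := ⟨K, hP.ext_mem _ _ _ hK A.property B.property⟩
  have hK_le : Θ K' ≤ Θ A + Θ B := hΘ.le_add (L := K') d e _ hK
  have hL_le : Θ L ≤ Θ K' + Θ N := hΘ.le_add (X := K') k _ η hη
  exact ⟨K', k, η, hη, by lia⟩

namespace IsSimple

lemma of_iso (hΘ : IsLengthFunction 𝓔 Θ) {M N : P.FullSubcategory} (hM : IsSimple 𝓔 Θ M)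
    (e : M.obj ≅ N.obj) : IsSimple 𝓔 Θ N := by
  refine ⟨fun h => hM.1 (h.of_iso e), ?_⟩
  rintro ⟨A, B, x, y, δ, ⟨h, hl⟩, hA, hB⟩
  exact hM.2 ⟨A, B, x ≫ e.inv, e.hom ≫ y, δ, ⟨h.of_iso e.symm rfl (by simp),
    by rw [hΘ.iso_invariant M N ⟨e⟩, hl]⟩, hA, hB⟩

lemma isIso_of_isThetaDeflation {M N : P.FullSubcategory} (hM : IsSimple 𝓔 Θ M)
    (hN : ¬ IsZero N.obj) {f : M.obj ⟶ N.obj} (hf : IsThetaDeflation 𝓔 Θ f) : IsIso f := by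
  obtain ⟨K, k, δ, hk⟩ := hf
  have hK : IsZero K.obj := by
    by_contra hK
    exact hM.2 ⟨K, N, k, f, δ, hk, hK, hN⟩
  exact hk.1.isIso_right hK

lemma isIso_of_isThetaInflation {M N : P.FullSubcategory} (hN : IsSimple 𝓔 Θ N)
    (hM : ¬ IsZero M.obj) {f : M.obj ⟶ N.obj} (hf : IsThetaInflation 𝓔 Θ f) : IsIso f := by
  obtain ⟨L, p, δ, hp⟩ := hf
  have hL : IsZero L.obj := by
    by_contra hL
    exact hN.2 ⟨M, L, f, p, δ, hp, hM, hL⟩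
  exact hp.1.isIso_left hL

end IsSimple

namespace IsLengthSubcategory

lemma isIso_of_isSimple (h : IsLengthSubcategory 𝓔 Θ) {M N : P.FullSubcategory}
    (hM : IsSimple 𝓔 Θ M) (hN : IsSimple 𝓔 Θ N) (f : M.obj ⟶ N.obj) (hf : f ≠ 0) : IsIso f := by
  obtain ⟨Z, i, j, rfl, hi, hj⟩ := h.admissible f
  have hZ : ¬ IsZero Z.obj := fun hZ => hf (by rw [hZ.eq_of_tgt i 0, zero_comp])
  have := hM.isIso_of_isThetaDeflation hZ hi
  have := hN.isIso_of_isThetaInflation hZ hj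
  infer_instance

lemma isSemibrick_sim (h : IsLengthSubcategory 𝓔 Θ) : IsSemibrick (sim 𝓔 ⟨P, Θ⟩) where
  iso_closed := ⟨by
    rintro M N e ⟨hM, hs⟩
    have hN := h.extensionClosed.iso_closed.of_iso e hM
    exact ⟨hN, hs.of_iso h.lengthFunction (N := ⟨N, hN⟩) e⟩⟩
  brick := by
    rintro M ⟨hM, hs⟩
    refine ⟨⟨0, 1, fun h₀ => hs.1 ((IsZero.iff_id_eq_zero M).2 h₀.symm)⟩, fun f hf => ?_⟩
    exact (isUnit_iff_isIso f).2 (h.isIso_of_isSimple hs hs f hf)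
  hom_eq_zero := by
    rintro M N ⟨hM, hs⟩ ⟨hN, ht⟩ hMN f
    by_contra hf
    have := h.isIso_of_isSimple hs ht f hf
    exact hMN ⟨asIso f⟩

lemma hom_eq_zero_of_ne (h : IsLengthSubcategory 𝓔 Θ) {M N : P.FullSubcategory}
    (hM : IsSimple 𝓔 Θ M) (hN : IsSimple 𝓔 Θ N) (hMN : Θ M ≠ Θ N) (f : M.obj ⟶ N.obj) :
    f = 0 := by
  by_contra hf
  have := h.isIso_of_isSimple hM hN f hf
  exact hMN (h.lengthFunction.iso_invariant M N ⟨asIso f⟩)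

lemma eq_one_of_isSimple (h : IsLengthSubcategory 𝓔 Θ) (hw : thetaOne Θ = thetaInfty Θ)
    {M : P.FullSubcategory} (hM : IsSimple 𝓔 Θ M) : Θ M = 1 := by
  have eq_one {N : P.FullSubcategory} (hN : thetaInfty Θ N) : Θ N = 1 :=
    h.normalized N (hw ▸ hN)
  by_contra hM₁
  obtain ⟨n, hn⟩ : ∃ n, Θ M = n + 2 := ⟨Θ M - 2, by have := h.lengthFunction.pos hM.1; lia⟩
  have hM_level : thetaLevel Θ (n + 1) M := by
    refine Or.inr ⟨fun N hN => ?_, hn⟩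
    have hN₁ := eq_one ⟨n, hN⟩
    have hNs := h.lengthFunction.isSimple_of_eq_one hN₁
    exact ⟨h.hom_eq_zero_of_ne hNs hM (by lia), h.hom_eq_zero_of_ne hM hNs (by lia)⟩
  exact hM₁ (eq_one ⟨_, hM_level⟩)

end IsLengthSubcategory

end LengthFunction

variable {X : ObjectProperty C}

namespace HasFiltration

lemma of_iso {n : ℕ} {M N : C} (h : HasFiltration 𝓔 X n M) (e : M ≅ N) :
    HasFiltration 𝓔 X n N := by
  cases h with
  | zero _ hM => exact .zero _ (hM.of_iso e.symm)
  | succ f g δ hL h hS =>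
    exact .succ (f ≫ e.hom) (e.inv ≫ g) δ hL (h.of_iso e rfl (by simp)) hS

lemma isZero {M : C} (h : HasFiltration 𝓔 X 0 M) : IsZero M := by
  cases h
  assumption

lemma extension {m n : ℕ} {A B D : C} {x : A ⟶ B} {y : B ⟶ D} {δ : Ext 𝓔.E D A}
    (hA : HasFiltration 𝓔 X m A) (hD : HasFiltration 𝓔 X n D) (h : IsTriangle 𝓔 x y δ) :
    HasFiltration 𝓔 X (m + n) B := by
  induction hD generalizing B with
  | zero D hD =>
    have := h.isIso_left hD
    exact hA.of_iso (asIso x)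
  | succ f g ε _ hε hS ih =>
    obtain ⟨N, d, e, k, δ', hδ', -, -, hN, -, -⟩ := 𝓔.et4op h hε
    exact .succ k _ δ' (ih hN) hδ' hS

lemma exists_triangle_of_succ {n : ℕ} {M : C} (h : HasFiltration 𝓔 X (n + 1) M) :
    ∃ (S L : C) (i : S ⟶ M) (p : M ⟶ L) (δ : Ext 𝓔.E L S),
      X S ∧ HasFiltration 𝓔 X n L ∧ IsTriangle 𝓔 i p δ := by
  induction n generalizing M with
  | zero =>
    obtain _ | @⟨_, L, _, S, f, g, δ, hL, h, hS⟩ := h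
    have := h.isIso_right hL.isZero
    exact ⟨S, L, inv g, 0, 0, hS, hL, .of_isIso_left _ _ hL.isZero⟩
  | succ n ih =>
    obtain _ | ⟨f, g, δ, hL, h, hS⟩ := h
    obtain ⟨S', L', i, p, ε, hS', hL', hε⟩ := ih hL
    obtain ⟨N, d, e, k, δ', hδ', -, -, hN, -, -⟩ := 𝓔.et4 hε h
    exact ⟨S', N, i ≫ f, k, δ', hS', .succ d e _ hL' hN hS, hδ'⟩

lemma hom_eq_zero_of_src {n : ℕ} {M N : C} (hN : HasFiltration 𝓔 X n N)
    (h : ∀ S, X S → ∀ f : M ⟶ S, f = 0) (f : M ⟶ N) : f = 0 := by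
  induction hN with
  | zero N hN => exact hN.eq_of_tgt _ _
  | succ i g δ _ ht hS ih =>
    obtain ⟨s, rfl⟩ := ht.exists_lift f (h _ hS _)
    rw [ih s, zero_comp]

lemma hom_eq_zero_of_tgt {n : ℕ} {M N : C} (hN : HasFiltration 𝓔 X n N)
    (h : ∀ S, X S → ∀ f : S ⟶ M, f = 0) (f : N ⟶ M) : f = 0 := by
  induction hN with
  | zero N hN => exact hN.eq_of_src _ _
  | succ i g δ _ ht hS ih =>
    obtain ⟨s, rfl⟩ := ht.exists_desc f (ih _)
    rw [h _ hS s, comp_zero]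

lemma exists_hom_to_ne_zero {n : ℕ} {M : C} (hM : HasFiltration 𝓔 X n M) (h₀ : ¬ IsZero M) :
    ∃ (S : C) (f : M ⟶ S), X S ∧ f ≠ 0 := by
  by_contra! h
  exact h₀ ((IsZero.iff_id_eq_zero M).2 (hM.hom_eq_zero_of_src (fun S hS f => h S f hS) _))

lemma exists_hom_from_ne_zero {n : ℕ} {M : C} (hM : HasFiltration 𝓔 X n M) (h₀ : ¬ IsZero M) :
    ∃ (S : C) (f : S ⟶ M), X S ∧ f ≠ 0 := by
  by_contra! h
  exact h₀ ((IsZero.iff_id_eq_zero M).2 (hM.hom_eq_zero_of_tgt (fun S hS f => h S f hS) _))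

lemma exists_triangle_of_hom_from (hX : IsSemibrick X) {n : ℕ} {M S : C}
    (hM : HasFiltration 𝓔 X n M) (hS : X S) (f : S ⟶ M) (hf : f ≠ 0) :
    ∃ (m : ℕ) (L : C) (p : M ⟶ L) (δ : Ext 𝓔.E L S),
      m + 1 = n ∧ HasFiltration 𝓔 X m L ∧ IsTriangle 𝓔 f p δ := by
  induction hM with
  | zero M hM => exact absurd (hM.eq_of_tgt f 0) hf
  | succ j g δ hL ht hT ih =>
    by_cases h₀ : f ≫ g = 0
    · obtain ⟨f, rfl⟩ := ht.exists_lift f h₀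
      obtain ⟨m, K, k, ε, rfl, hK, hk⟩ := ih f (fun h => hf (by rw [h, zero_comp]))
      obtain ⟨N, d, e, q, δ', hδ', -, -, hN, -, -⟩ := 𝓔.et4 hk ht
      exact ⟨m + 1, N, q, δ', rfl, .succ d e _ hK hN hT, hδ'⟩
    · have := hX.isIso_of_ne_zero hS hT _ h₀
      obtain ⟨p, hp⟩ := ht.exists_cone_of_isIso_comp f
      exact ⟨_, _, p, 0, rfl, hL, hp⟩

end HasFiltration

lemma exists_le_of_hasFiltration_sim {P : ObjectProperty C}
    {Θ : P.FullSubcategory → ℕ} (hP : IsExtensionClosed 𝓔 P) (hΘ : IsLengthFunction 𝓔 Θ)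
    (h₁ : ∀ M : P.FullSubcategory, IsSimple 𝓔 Θ M → Θ M = 1) {n : ℕ} {M : C}
    (hM : HasFiltration 𝓔 (sim 𝓔 ⟨P, Θ⟩) n M) : ∃ hM : P M, Θ ⟨M, hM⟩ ≤ n := by
  induction hM with
  | zero M hM => exact ⟨hP.zero_mem M hM, ((hΘ.eq_zero_iff _).2 hM).le⟩
  | @succ n L M S f g δ _ ht hS ih =>
    obtain ⟨hL, hL_le⟩ := ih
    obtain ⟨hS, hs⟩ := hS
    have hM := hP.ext_mem f g δ ht hL hS
    have hM_le : Θ ⟨M, hM⟩ ≤ Θ ⟨L, hL⟩ + Θ ⟨S, hS⟩ := hΘ.le_add _ _ δ ht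
    have hS_eq := h₁ _ hs
    exact ⟨hM, by lia⟩

section FiltLength

lemma filt_isExtensionClosed (X : ObjectProperty C) : IsExtensionClosed 𝓔 (Filt 𝓔 X) where
  iso_closed := ⟨fun e ⟨n, h⟩ => ⟨n, h.of_iso e⟩⟩
  zero_mem M hM := ⟨0, .zero M hM⟩
  ext_mem := by
    rintro A B D x y δ h ⟨m, hA⟩ ⟨n, hD⟩
    exact ⟨m + n, hA.extension hD h⟩

lemma hasFiltration_filtLength (M : (Filt 𝓔 X).FullSubcategory) :
    HasFiltration 𝓔 X (filtLength 𝓔 X M) M.obj :=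
  Nat.sInf_mem (s := {n | HasFiltration 𝓔 X n M.obj}) M.property

lemma filtLength_le {M : (Filt 𝓔 X).FullSubcategory} {n : ℕ} (h : HasFiltration 𝓔 X n M.obj) :
    filtLength 𝓔 X M ≤ n :=
  Nat.sInf_le h

lemma filtLength_eq_zero_iff (M : (Filt 𝓔 X).FullSubcategory) :
    filtLength 𝓔 X M = 0 ↔ IsZero M.obj :=
  ⟨fun h => (h ▸ hasFiltration_filtLength M).isZero,
    fun h => Nat.le_zero.1 (filtLength_le (.zero _ h))⟩

lemma filtLength_congr {M N : (Filt 𝓔 X).FullSubcategory} (e : M.obj ≅ N.obj) :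
    filtLength 𝓔 X M = filtLength 𝓔 X N :=
  le_antisymm (filtLength_le ((hasFiltration_filtLength N).of_iso e.symm))
    (filtLength_le ((hasFiltration_filtLength M).of_iso e))

lemma filtLength_le_add {A B D : (Filt 𝓔 X).FullSubcategory} {x : A.obj ⟶ B.obj}
    {y : B.obj ⟶ D.obj} {δ : Ext 𝓔.E D.obj A.obj} (h : IsTriangle 𝓔 x y δ) :
    filtLength 𝓔 X B ≤ filtLength 𝓔 X A + filtLength 𝓔 X D :=
  filtLength_le ((hasFiltration_filtLength A).extension (hasFiltration_filtLength D) h)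

end FiltLength

open scoped ZeroObject

variable [HasZeroObject C]

lemma isThetaDeflation_id {P : ObjectProperty C} {Θ : P.FullSubcategory → ℕ}
    (hP : IsExtensionClosed 𝓔 P) (hΘ : IsLengthFunction 𝓔 Θ) (M : P.FullSubcategory) :
    IsThetaDeflation 𝓔 Θ (L := M) (M := M) (𝟙 M.obj) := by
  refine ⟨⟨0, hP.zero_mem _ (isZero_zero C)⟩, 0, 0, .of_isIso_right _ _ (isZero_zero C), ?_⟩
  rw [(hΘ.eq_zero_iff ⟨0, _⟩).2 (isZero_zero C), zero_add]

section Semibrick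

lemma HasFiltration.of_mem {S : C} (hS : X S) : HasFiltration 𝓔 X 1 S :=
  .succ (0 : (0 : C) ⟶ S) (𝟙 S) 0 (.zero _ (isZero_zero C))
    (.of_isIso_right _ _ (isZero_zero C)) hS

lemma HasFiltration.exists_triangle_of_hom_to (hX : IsSemibrick X) {n : ℕ} {M S : C}
    (hM : HasFiltration 𝓔 X n M) (hS : X S) (f : M ⟶ S) (hf : f ≠ 0) :
    ∃ (m : ℕ) (K : C) (k : K ⟶ M) (δ : Ext 𝓔.E S K),
      m + 1 = n ∧ HasFiltration 𝓔 X m K ∧ IsTriangle 𝓔 k f δ := by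
  induction n generalizing M with
  | zero => exact absurd (hM.isZero.eq_of_src f 0) hf
  | succ n ih =>
    obtain ⟨T, L, i, p, δ, hT, hL, ht⟩ := hM.exists_triangle_of_succ
    by_cases h₀ : i ≫ f = 0
    · obtain ⟨f, rfl⟩ := ht.exists_desc f h₀
      obtain ⟨m, K, k, ε, rfl, hK, hk⟩ := ih hL f (fun h => hf (by rw [h, comp_zero]))
      obtain ⟨N, d, e, q, δ', hδ', -, -, hN, -, -⟩ := 𝓔.et4op ht hk
      exact ⟨1 + m, N, q, δ', by lia, (of_mem hT).extension hK hN, hδ'⟩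
    · have := hX.isIso_of_ne_zero hT hS _ h₀
      obtain ⟨k, hk⟩ := ht.exists_cocone_of_isIso_comp f
      exact ⟨n, L, k, 0, rfl, hL, hk⟩

lemma le_filt : X ≤ Filt 𝓔 X := fun _ hS => ⟨1, .of_mem hS⟩

lemma exists_mem_hom_to_ne_zero {M : (Filt 𝓔 X).FullSubcategory} (hM : ¬ IsZero M.obj) :
    ∃ (S : (Filt 𝓔 X).FullSubcategory) (f : M.obj ⟶ S.obj), X S.obj ∧ f ≠ 0 := by
  obtain ⟨S, f, hS, hf⟩ := (hasFiltration_filtLength M).exists_hom_to_ne_zero hM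
  exact ⟨⟨S, le_filt S hS⟩, f, hS, hf⟩

lemma exists_mem_hom_from_ne_zero {M : (Filt 𝓔 X).FullSubcategory} (hM : ¬ IsZero M.obj) :
    ∃ (S : (Filt 𝓔 X).FullSubcategory) (f : S.obj ⟶ M.obj), X S.obj ∧ f ≠ 0 := by
  obtain ⟨S, f, hS, hf⟩ := (hasFiltration_filtLength M).exists_hom_from_ne_zero hM
  exact ⟨⟨S, le_filt S hS⟩, f, hS, hf⟩

lemma filtLength_of_mem (hX : IsSemibrick X) {S : (Filt 𝓔 X).FullSubcategory} (hS : X S.obj) :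
    filtLength 𝓔 X S = 1 :=
  le_antisymm (filtLength_le (.of_mem hS)) <| Nat.one_le_iff_ne_zero.2 <|
    mt (filtLength_eq_zero_iff S).1 (hX.brick _ hS).not_isZero

lemma isThetaDeflation_of_ne_zero (hX : IsSemibrick X) {M S : (Filt 𝓔 X).FullSubcategory}
    (hS : X S.obj) (f : M.obj ⟶ S.obj) (hf : f ≠ 0) :
    IsThetaDeflation 𝓔 (filtLength 𝓔 X) f := by
  obtain ⟨m, K, k, δ, hm, hK, h⟩ :=
    (hasFiltration_filtLength M).exists_triangle_of_hom_to hX hS f hf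
  refine ⟨⟨K, m, hK⟩, k, δ, h, ?_⟩
  have hK_le : filtLength 𝓔 X ⟨K, m, hK⟩ ≤ m := filtLength_le hK
  have hM_le := filtLength_le_add (A := ⟨K, m, hK⟩) h
  have hS_eq := filtLength_of_mem hX hS
  lia

lemma isThetaInflation_of_ne_zero (hX : IsSemibrick X) {M S : (Filt 𝓔 X).FullSubcategory}
    (hS : X S.obj) (f : S.obj ⟶ M.obj) (hf : f ≠ 0) :
    IsThetaInflation 𝓔 (filtLength 𝓔 X) f := by
  obtain ⟨m, L, p, δ, hm, hL, h⟩ :=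
    (hasFiltration_filtLength M).exists_triangle_of_hom_from hX hS f hf
  refine ⟨⟨L, m, hL⟩, p, δ, h, ?_⟩
  have hL_le : filtLength 𝓔 X ⟨L, m, hL⟩ ≤ m := filtLength_le hL
  have hM_le := filtLength_le_add (D := ⟨L, m, hL⟩) h
  have hS_eq := filtLength_of_mem hX hS
  lia

lemma isStableTriangle_of_ne_zero (hX : IsSemibrick X) {K M S : (Filt 𝓔 X).FullSubcategory}
    (hS : X S.obj) {k : K.obj ⟶ M.obj} {f : M.obj ⟶ S.obj} {δ : Ext 𝓔.E S.obj K.obj}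
    (h : IsTriangle 𝓔 k f δ) (hf : f ≠ 0) : IsStableTriangle 𝓔 (filtLength 𝓔 X) k f δ := by
  obtain ⟨L, l, ε, hl, hM⟩ := isThetaDeflation_of_ne_zero hX hS f hf
  obtain ⟨e⟩ := h.nonempty_iso_of_deflation hl
  exact ⟨h, by rw [hM, filtLength_congr e]⟩

lemma filtLength_eq_add (hX : IsSemibrick X) {A B D : (Filt 𝓔 X).FullSubcategory}
    {x : A.obj ⟶ B.obj} {y : B.obj ⟶ D.obj} (h : IsTriangle 𝓔 x y (0 : Ext 𝓔.E D.obj A.obj)) :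
    filtLength 𝓔 X B = filtLength 𝓔 X A + filtLength 𝓔 X D := by
  induction hn : filtLength 𝓔 X D generalizing B D with
  | zero =>
    have := h.isIso_left ((filtLength_eq_zero_iff D).1 hn)
    rw [filtLength_congr (asIso x), add_zero]
  | succ n ih =>
    obtain ⟨S, f, hS, hf⟩ := exists_mem_hom_to_ne_zero (M := D)
      (mt (filtLength_eq_zero_iff D).2 (by lia))
    obtain ⟨D', k, δ, hk, hD⟩ := isThetaDeflation_of_ne_zero hX hS f hf
    have hyf : y ≫ f ≠ 0 := by
      obtain ⟨s, hs⟩ := h.exists_coextend (𝟙 D.obj) (by simp)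
      exact fun h₀ => hf (by simpa [reassoc_of% hs] using s ≫= h₀)
    obtain ⟨N, d, e, k', δ', hδ', -, -, hN, -, -⟩ := 𝓔.et4op h hk
    rw [pull_zero] at hN
    let N' : (Filt 𝓔 X).FullSubcategory :=
      ⟨N, (filt_isExtensionClosed X).ext_mem _ _ _ hN A.property D'.property⟩
    have hB := (isStableTriangle_of_ne_zero (K := N') hX hS hδ' hyf).2
    have hS_eq := filtLength_of_mem hX hS
    have hN' : filtLength 𝓔 X N' = filtLength 𝓔 X A + n := ih hN (by lia)
    lia

lemma filtLength_isLengthFunction (hX : IsSemibrick X) :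
    IsLengthFunction 𝓔 (filtLength 𝓔 X) where
  iso_invariant _ _ := fun ⟨e⟩ => filtLength_congr e
  eq_zero_iff := filtLength_eq_zero_iff
  le_add _ _ _ h := filtLength_le_add h
  eq_add _ _ h := filtLength_eq_add hX h

lemma isThetaInflation_of_isMonoOn (hX : IsSemibrick X) {Z N : (Filt 𝓔 X).FullSubcategory}
    (g : Z.obj ⟶ N.obj) (hg : IsMonoOn X g) : IsThetaInflation 𝓔 (filtLength 𝓔 X) g := by
  induction hn : filtLength 𝓔 X Z generalizing Z N with
  | zero =>
    exact ⟨N, 𝟙 _, 0, .of_isIso_right _ _ ((filtLength_eq_zero_iff Z).1 hn), by lia⟩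
  | succ n ih =>
    obtain ⟨S, i, hS, hi⟩ := exists_mem_hom_from_ne_zero (M := Z)
      (mt (filtLength_eq_zero_iff Z).2 (by lia))
    obtain ⟨Z', p, δ, hp, hZ⟩ := isThetaInflation_of_ne_zero hX hS i hi
    obtain ⟨N', q, ε, hq, hN⟩ :=
      isThetaInflation_of_ne_zero hX hS (i ≫ g) (fun h => hi (hg hS i h))
    obtain ⟨g', hg', hδ⟩ := 𝓔.et3 hp hq (𝟙 _) g (by simp)
    rw [push_id] at hδ
    have hS_eq := filtLength_of_mem hX hS
    obtain ⟨W, r, η, hr, hN'⟩ := ih g' (hp.isMonoOn_of_fill hq rfl hg' hδ hg) (by lia)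
    obtain ⟨θ, hθ⟩ := hp.exists_of_fill hq rfl hg' hδ (hg hS) hr
    exact ⟨W, q ≫ r, θ, hθ, by lia⟩

lemma IsThetaDeflation.isAdmissible_comp (hX : IsSemibrick X)
    {M Z N : (Filt 𝓔 X).FullSubcategory} {a : M.obj ⟶ Z.obj}
    (ha : IsThetaDeflation 𝓔 (filtLength 𝓔 X) a) (b : Z.obj ⟶ N.obj) :
    IsAdmissible 𝓔 (filtLength 𝓔 X) (M := M) (N := N) (a ≫ b) := by
  induction hn : filtLength 𝓔 X Z using Nat.strong_induction_on generalizing Z with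
  | h n ih =>
    by_cases hb : IsMonoOn X b
    · exact ⟨Z, a, b, rfl, ha, isThetaInflation_of_isMonoOn hX b hb⟩
    · obtain ⟨S, hS, s, hsb, hs⟩ : ∃ S, X S ∧ ∃ s : S ⟶ Z.obj, s ≫ b = 0 ∧ s ≠ 0 := by
        simpa [IsMonoOn] using hb
      let S' : (Filt 𝓔 X).FullSubcategory := ⟨S, le_filt S hS⟩
      obtain ⟨Z', p, δ, hp, hZ⟩ := isThetaInflation_of_ne_zero (S := S') hX hS s hs
      obtain ⟨b, rfl⟩ := hp.exists_desc b hsb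
      have hS_eq : filtLength 𝓔 X S' = 1 := filtLength_of_mem hX hS
      rw [← Category.assoc]
      exact ih (filtLength 𝓔 X Z') (by lia) (ha.comp (filt_isExtensionClosed X)
        (filtLength_isLengthFunction hX) ⟨S', s, δ, hp, hZ⟩) b rfl

lemma isAdmissible_filtLength (hX : IsSemibrick X) {M N : (Filt 𝓔 X).FullSubcategory}
    (f : M.obj ⟶ N.obj) : IsAdmissible 𝓔 (filtLength 𝓔 X) f := by
  have hid := isThetaDeflation_id (filt_isExtensionClosed X) (filtLength_isLengthFunction hX) M
  simpa only [Category.id_comp] using hid.isAdmissible_comp hX f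

lemma filtLength_eq_one_of_thetaOne (hX : IsSemibrick X) {M : (Filt 𝓔 X).FullSubcategory}
    (hM : thetaOne (filtLength 𝓔 X) M) : filtLength 𝓔 X M = 1 := by
  obtain ⟨S, f, hS, -⟩ := exists_mem_hom_to_ne_zero hM.1
  have hM_le : filtLength 𝓔 X M ≤ 1 :=
    filtLength_of_mem hX hS ▸ hM.2 S (hX.brick _ hS).not_isZero
  exact le_antisymm hM_le ((filtLength_isLengthFunction hX).pos hM.1)

theorem filtPair_isLengthWide (hX : IsSemibrick X) : IsLengthWide 𝓔 (filtPair 𝓔 X) where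
  left :=
    { extensionClosed := filt_isExtensionClosed X
      lengthFunction := filtLength_isLengthFunction hX
      admissible := isAdmissible_filtLength hX
      normalized := fun _ => filtLength_eq_one_of_thetaOne hX }
  right := thetaOne_eq_thetaInfty fun M hM => by
    obtain ⟨S, f, hS, hf⟩ := exists_mem_hom_to_ne_zero (mt (filtLength_eq_zero_iff M).2 hM)
    exact ⟨S, f, (filtLength_isLengthFunction hX).thetaOne_of_eq_one (filtLength_of_mem hX hS), hf⟩

theorem sim_filtPair (hX : IsSemibrick X) : sim 𝓔 (filtPair 𝓔 X) = X := by
  ext M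
  refine ⟨fun ⟨hM, hs⟩ => ?_, fun hM => ⟨le_filt M hM,
    (filtLength_isLengthFunction hX).isSimple_of_eq_one (filtLength_of_mem hX hM)⟩⟩
  obtain ⟨S, f, hS, hf⟩ := exists_mem_hom_to_ne_zero hs.1
  have := hs.isIso_of_isThetaDeflation (hX.brick _ hS).not_isZero
    (isThetaDeflation_of_ne_zero hX hS f hf)
  exact hX.iso_closed.of_iso (asIso f).symm hS

end Semibrick

section SimpleObjects

variable {P : ObjectProperty C} {Θ : P.FullSubcategory → ℕ}

lemma hasFiltration_sim (hΘ : IsLengthFunction 𝓔 Θ)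
    (h₁ : ∀ M : P.FullSubcategory, IsSimple 𝓔 Θ M → Θ M = 1) (M : P.FullSubcategory) :
    HasFiltration 𝓔 (sim 𝓔 ⟨P, Θ⟩) (Θ M) M.obj := by
  induction hn : Θ M using Nat.strong_induction_on generalizing M with
  | h n ih =>
    subst hn
    by_cases h₀ : IsZero M.obj
    · exact (hΘ.eq_zero_iff M).2 h₀ ▸ .zero _ h₀
    by_cases hs : IsSimple 𝓔 Θ M
    · exact h₁ M hs ▸ .of_mem ⟨M.property, hs⟩
    · obtain ⟨A, B, x, y, δ, ⟨ht, hl⟩, hA, hB⟩ := not_not.1 (not_and.1 hs h₀)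
      have := hΘ.pos hA
      have := hΘ.pos hB
      exact hl ▸ (ih _ (by lia) A rfl).extension (ih _ (by lia) B rfl) ht

theorem filtPair_sim (hP : IsExtensionClosed 𝓔 P) (hΘ : IsLengthFunction 𝓔 Θ)
    (h₁ : ∀ M : P.FullSubcategory, IsSimple 𝓔 Θ M → Θ M = 1) :
    filtPair 𝓔 (sim 𝓔 ⟨P, Θ⟩) = ⟨P, Θ⟩ := by
  refine SubcategoryWithLength.ext ?_ fun M hV hW => le_antisymm ?_ ?_
  · ext M
    exact ⟨fun ⟨n, hM⟩ => (exists_le_of_hasFiltration_sim hP hΘ h₁ hM).1,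
      fun hM => ⟨_, hasFiltration_sim hΘ h₁ ⟨M, hM⟩⟩⟩
  · exact filtLength_le (hasFiltration_sim hΘ h₁ ⟨M, hW⟩)
  · exact (exists_le_of_hasFiltration_sim hP hΘ h₁ (hasFiltration_filtLength ⟨M, hV⟩)).2

end SimpleObjects

end Extri

theorem theorem3_general {C : Type u} [Category.{v} C] [Preadditive C] [HasZeroObject C]
    [HasBinaryBiproducts C] (𝓔 : Extri.ExtriangulatedStructure.{w} C) :
    Set.BijOn (Extri.filtPair 𝓔) {X : ObjectProperty C | Extri.IsSemibrick X}
      {W | Extri.IsLengthWide 𝓔 W} ∧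
    Set.BijOn (Extri.sim 𝓔) {W | Extri.IsLengthWide 𝓔 W}
      {X : ObjectProperty C | Extri.IsSemibrick X} ∧
    Set.InvOn (Extri.sim 𝓔) (Extri.filtPair 𝓔)
      {X : ObjectProperty C | Extri.IsSemibrick X} {W | Extri.IsLengthWide 𝓔 W} := by
  have hfilt : Set.MapsTo (Extri.filtPair 𝓔) {X : ObjectProperty C | Extri.IsSemibrick X}
      {W | Extri.IsLengthWide 𝓔 W} := fun _ hX => Extri.filtPair_isLengthWide hX
  have hsim : Set.MapsTo (Extri.sim 𝓔) {W | Extri.IsLengthWide 𝓔 W}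
      {X : ObjectProperty C | Extri.IsSemibrick X} := fun _ hW => hW.1.isSemibrick_sim
  have hinv : Set.InvOn (Extri.sim 𝓔) (Extri.filtPair 𝓔)
      {X : ObjectProperty C | Extri.IsSemibrick X} {W | Extri.IsLengthWide 𝓔 W} :=
    ⟨fun _ hX => Extri.sim_filtPair hX, fun _ ⟨h, hw⟩ => Extri.filtPair_sim h.extensionClosed
      h.lengthFunction fun _ hM => h.eq_one_of_isSimple hw hM⟩
  exact ⟨hinv.bijOn hfilt hsim, hinv.symm.bijOn hsim hfilt, hinv⟩

theorem theorem3 {C : Type u} [Category.{v} C] [Preadditive C] [HasZeroObject C]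
    [HasBinaryBiproducts C] (hKS : Extri.IsKrullSchmidt C)
    (𝓔 : Extri.ExtriangulatedStructure.{w} C) :
    Set.BijOn (Extri.filtPair 𝓔) {X : ObjectProperty C | Extri.IsSemibrick X} {W | Extri.IsLengthWide 𝓔 W} ∧
    Set.BijOn (Extri.sim 𝓔) {W | Extri.IsLengthWide 𝓔 W} {X : ObjectProperty C | Extri.IsSemibrick X} ∧
    Set.InvOn (Extri.sim 𝓔) (Extri.filtPair 𝓔)
      {X : ObjectProperty C | Extri.IsSemibrick X} {W | Extri.IsLengthWide 𝓔 W} :=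
  theorem3_general 𝓔
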